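/- Lemma L:eigen-green (Lemma 2.3). Let $\kappa>0$ and $u_0(x)=-2\kappa^2\,\mathrm{sech}^2(\kappa x)$. Put $\theta(y)=1$ for $y>0$ and $\theta(y)=0$ otherwise, and, for $x\in\mathbb R$, $\mu\in\mathbb C$, $$\varphi_\pm(x,\mu)=1\mp\frac{2i\kappa}{\mu\pm i\kappa}\,\frac1{1+e^{-2\kappa x}},\qquad \vartheta_\pm(x,\mu)=1\mp\frac{2i\kappa}{\mu\pm i\kappa}\,\frac1{1+e^{2\kappa x}},$$ $$\phi_\pm(x,\mu)=\varphi_\pm(x,\mu)e^{\mp i\mu x},\qquad \psi_\pm(x,\mu)=\vartheta_\pm(x,\mu)e^{\pm i\mu x}.$$ On the upper and lower half planes $\mathbb C^\pm$ let $a(\mu)=\frac{\mu\mp i\kappa}{\mu\pm i\kappa}$, and let $$P(x,x',\mu)=\begin{cases}\phi_+(x,\mu)\psi_+(x',\mu),&\mu\in\mathbb C^+,\\ \phi_-(x',\mu)\psi_-(x,\mu),&\mu\in\mathbb C^-,\end{cases}\qquad \mathfrak g(x,x',\mu)=\begin{cases}\varphi_+(x,\mu)\vartheta_+(x',\mu),&\mu\in\mathbb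 C^+,\\ \varphi_-(x',\mu)\vartheta_-(x,\mu),&\mu\in\mathbb C^-.\end{cases}$$ For $\lambda=\lambda_R+i\lambda_I$ let $\chi_+$ and $\chi_-$ be the characteristic functions of the sets of $\lambda'\in\mathbb R$ with $\mathrm{Re}(\lambda^2-(\lambda+\lambda')^2)>0$ and $<0$, respectively. For $x,x',y\in\mathbb R$, $y\neq0$, and $\lambda\notin\mathbb R\cup i\mathbb R\cup(\mathbb R+i\kappa)\cup(\mathbb R-i\kappa)$, the Green function $\widetilde G$ of $\partial_y-\partial_x^2+2i\lambda\partial_x+u_0$ is $$\widetilde G(x,x',y,\lambda)=e^{i\lambda(x-x')}\bigl(G_c+G_d\bigr)(x,x',y,\lambda),$$ $$G_c=\int_{\mathbb R}\bigl(\theta(y)\chi_-(\lambda')-\theta(-y)\chi_+(\lambda')\bigr)e^{(\lambda^2-[\lambda+\lambda']^2)y}\,\frac{P(x,x',\lambda+\lambda')}{2\pi a(\lambda+\lambda')}\,d\lambda',$$ $$G_d=-2\kappa\,\theta(-y)\,\theta(\kappa-|\lambda_I|)\,e^{(\lambda^2+\kappa^2)y\pm\kappa(x-x')}\,\mathfrak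 g(x,x',\pm i\kappa)\qquad\text{for }\lambda\in\mathbb C^\pm.$$ Then for every $\kappa>0$ there is a constant $C$, depending only on $\kappa$, such that for all $x,x',y\in\mathbb R$ with $y\ne0$ and all $\lambda\notin\mathbb R\cup i\mathbb R\cup(\mathbb R+i\kappa)\cup(\mathbb R-i\kappa)$ the integral defining $G_c$ converges absolutely and $$|\widetilde G(x,x',y,\lambda)|\le C\left(1+\frac1{\sqrt{|y|}}\right).$$ -/

import Mathlib

noncomputable section

namespace KPII

/-- Heaviside function: `1` for `y > 0`, `0` elsewhere. -/
def heaviside (y : ℝ) : ℝ := if 0 < y then 1 else 0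

/-- `φ₊`-amplitude `1 - (2iκ / (λ + iκ)) / (1 + exp (-2κx))`. -/
def varphiPlus (κ x : ℝ) (lam : ℂ) : ℂ :=
  1 - 2 * Complex.I * κ / (lam + Complex.I * κ) * (1 / (1 + Real.exp (-2 * κ * x)) : ℝ)

/-- `φ₋`-amplitude `1 + (2iκ / (λ - iκ)) / (1 + exp (-2κx))`. -/
def varphiMinus (κ x : ℝ) (lam : ℂ) : ℂ :=
  1 + 2 * Complex.I * κ / (lam - Complex.I * κ) * (1 / (1 + Real.exp (-2 * κ * x)) : ℝ)

/-- `ψ₊`-amplitude `1 - (2iκ / (λ + iκ)) / (1 + exp (2κx))`. -/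
def varthetaPlus (κ x : ℝ) (lam : ℂ) : ℂ :=
  1 - 2 * Complex.I * κ / (lam + Complex.I * κ) * (1 / (1 + Real.exp (2 * κ * x)) : ℝ)

/-- `ψ₋`-amplitude `1 + (2iκ / (λ - iκ)) / (1 + exp (2κx))`. -/
def varthetaMinus (κ x : ℝ) (lam : ℂ) : ℂ :=
  1 + 2 * Complex.I * κ / (lam - Complex.I * κ) * (1 / (1 + Real.exp (2 * κ * x)) : ℝ)

/-- The Jost solutions of `-f'' + u₀ f = λ² f`, where `u₀(x) = -2κ² sech² (κx)`. -/
def phiPlus (κ x : ℝ) (lam : ℂ) : ℂ :=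
  varphiPlus κ x lam * Complex.exp (-Complex.I * lam * x)

def phiMinus (κ x : ℝ) (lam : ℂ) : ℂ :=
  varphiMinus κ x lam * Complex.exp (Complex.I * lam * x)

def psiPlus (κ x : ℝ) (lam : ℂ) : ℂ :=
  varthetaPlus κ x lam * Complex.exp (Complex.I * lam * x)

def psiMinus (κ x : ℝ) (lam : ℂ) : ℂ :=
  varthetaMinus κ x lam * Complex.exp (-Complex.I * lam * x)

/-- `a = a₊ = (λ - iκ) / (λ + iκ)` on the upper half plane and
`a = a₋ = (λ + iκ) / (λ - iκ)` on the lower one. -/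
def a (κ : ℝ) (lam : ℂ) : ℂ :=
  if 0 < lam.im then (lam - Complex.I * κ) / (lam + Complex.I * κ)
  else (lam + Complex.I * κ) / (lam - Complex.I * κ)

/-- `χ₊`: characteristic function of `{s ∈ ℝ | Re (λ² - (λ + s)²) > 0}`. -/
def chiPlus (lam : ℂ) (s : ℝ) : ℝ := if 0 < (lam ^ 2 - (lam + s) ^ 2).re then 1 else 0

/-- `χ₋`: characteristic function of `{s ∈ ℝ | Re (λ² - (λ + s)²) < 0}`. -/
def chiMinus (lam : ℂ) (s : ℝ) : ℝ := if (lam ^ 2 - (lam + s) ^ 2).re < 0 then 1 else 0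

/-- The product of Jost solutions that enters the continuous part: `φ₊(x, μ) ψ₊(x', μ)` on the
upper half plane, `φ₋(x', μ) ψ₋(x, μ)` on the lower one. -/
def jostProd (κ x x' : ℝ) (mu : ℂ) : ℂ :=
  if 0 < mu.im then phiPlus κ x mu * psiPlus κ x' mu else phiMinus κ x' mu * psiMinus κ x mu

/-- Integrand of the continuous part of the Green function. -/
def greenIntegrand (κ x x' y : ℝ) (lam : ℂ) (s : ℝ) : ℂ :=
  ((heaviside y * chiMinus lam s - heaviside (-y) * chiPlus lam s : ℝ) : ℂ) *
    Complex.exp ((lam ^ 2 - (lam + s) ^ 2) * y) *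
    (jostProd κ x x' (lam + s) / (2 * Real.pi * a κ (lam + s)))

/-- The continuous part `G_c`. -/
def greenC (κ x x' y : ℝ) (lam : ℂ) : ℂ := ∫ s : ℝ, greenIntegrand κ x x' y lam s

/-- The function `𝔤`: `varphi₊(x, μ) vartheta₊(x', μ)` on the upper half plane,
`varphi₋(x', μ) vartheta₋(x, μ)` on the lower one. -/
def gFun (κ x x' : ℝ) (mu : ℂ) : ℂ :=
  if 0 < mu.im then varphiPlus κ x mu * varthetaPlus κ x' mu
  else varphiMinus κ x' mu * varthetaMinus κ x mu

/-- The discrete part `G_d`, with the upper choice of sign on the upper half plane and the lower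
choice on the lower one. The factor `2κ` normalizes the bound state: the square of the `L²` norm
of `x ↦ φ₊(x, iκ) = sech (κx) / 2` is `1 / (2κ)`. -/
def greenD (κ x x' y : ℝ) (lam : ℂ) : ℂ :=
  -2 * κ * heaviside (-y) * heaviside (κ - |lam.im|) *
    (if 0 < lam.im then
      Complex.exp ((lam ^ 2 + κ ^ 2) * y + κ * (x - x')) * gFun κ x x' (Complex.I * κ)
    else
      Complex.exp ((lam ^ 2 + κ ^ 2) * y - κ * (x - x')) * gFun κ x x' (-(Complex.I * κ)))

/-- The Green function `G` of `∂_y - ∂_x² + u₀ - λ²`. -/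
def green (κ x x' y : ℝ) (lam : ℂ) : ℂ := greenC κ x x' y lam + greenD κ x x' y lam

/-- The Green function `G̃ = G exp (iλ(x - x'))` of `∂_y - ∂_x² + 2iλ∂_x + u₀`. -/
def greenTilde (κ x x' y : ℝ) (lam : ℂ) : ℂ :=
  green κ x x' y lam * Complex.exp (Complex.I * lam * (x - x'))

end KPII

end

namespace KPII

open Real Set MeasureTheory intervalIntegral

/-! The product of Jost solutions over `a` is an exponential times a rational function of μ with
simple poles at ±iκ only, given by one formula on both half planes. Substituting t = re(λ + s) and
including the factor exp(iλ(x-x')), all growth in x - x' cancels. What remains, up to a factor of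
modulus 1/(2π), is an even weight w(t) = exp((b² - t²)y), cut off to where the exponent is negative,
times exp(-iAt), with A = x - x' + 2yλ_I real, times 1 or 1/(t + id), d = λ_I ∓ κ.

The term 1 costs the mass of w, which is O(1/√|y|) by comparison with two Gaussians
(`integral_gaussWeight_le`). The pole terms must be bounded uniformly as d → 0, where absolute
values can lose a logarithm. Averaging over t and -t leaves d cos(At)/(t² + d²), dominated by the
Cauchy kernel of mass π, and t sin(At)/(t² + d²). For the latter, |sin(At)| ≤ |At| suffices when |t|
≤ 1/|A|; beyond, w is monotone in |t| with values in [0,1], and one integration by parts gives a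
bound independent of all parameters (`abs_integral_exp_mul_sin_le`).

In the discrete part (`norm_greenD_mul_cexp_le`) the exponential in y is at most 1, and the tails of
the bound state absorb the exponentials in x and x'. -/

/-! ### Oscillatory integrals on a half-line, uniform in all parameters -/

theorem abs_integral_mul_sin_le {f f' : ℝ → ℝ} {p q A M V : ℝ} (hpq : p ≤ q) (hA : 0 < A)
    (hf : ∀ t ∈ Icc p q, HasDerivAt f (f' t) t) (hf' : ContinuousOn f' (Icc p q))
    (hM : ∀ t ∈ Icc p q, |f t| ≤ M) (hV : ∫ t in p..q, |f' t| ≤ V) :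
    |∫ t in p..q, f t * sin (A * t)| ≤ (2 * M + V) / A := by
  rw [← uIcc_of_le hpq] at hf hf'
  have hv : ∀ t ∈ uIcc p q, HasDerivAt (fun t => -cos (A * t) / A) (sin (A * t)) t := by
    intro t _
    have := (((hasDerivAt_id t).const_mul A).cos.neg).div_const A
    refine this.congr_deriv ?_
    simp
    field_simp
  have hsin : IntervalIntegrable (fun t => sin (A * t)) volume p q :=
    Continuous.intervalIntegrable (by fun_prop) _ _
  -- The antiderivative -cos(At)/A gains 1/A: the boundary terms cost 2M/A, the remaining integral
  -- V/A.
  rw [integral_mul_deriv_eq_deriv_mul hf hv hf'.intervalIntegrable hsin]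
  have hb : ∀ t ∈ Icc p q, |f t * (-cos (A * t) / A)| ≤ M / A := by
    intro t ht
    rw [abs_mul, abs_div, abs_neg, abs_of_pos hA, mul_div_assoc']
    have h1 := hM t ht
    have h2 := abs_cos_le_one (A * t)
    have := abs_nonneg (f t)
    gcongr
    nlinarith
  have hi : |∫ t in p..q, f' t * (-cos (A * t) / A)| ≤ V / A := by
    calc |∫ t in p..q, f' t * (-cos (A * t) / A)|
        ≤ ∫ t in p..q, |f' t| / A := by
          rw [← Real.norm_eq_abs]
          refine norm_integral_le_of_norm_le hpq (Filter.Eventually.of_forall fun t _ => ?_)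
            (hf'.abs.intervalIntegrable.div_const A)
          rw [Real.norm_eq_abs, abs_mul, abs_div, abs_neg, abs_of_pos hA, mul_div_assoc']
          have h2 := abs_cos_le_one (A * t)
          have := abs_nonneg (f' t)
          gcongr
          nlinarith
      _ = (∫ t in p..q, |f' t|) / A := by rw [intervalIntegral.integral_div]
      _ ≤ V / A := by gcongr
  have h1 := hb p (left_mem_Icc.2 hpq)
  have h2 := hb q (right_mem_Icc.2 hpq)
  have : (2 * M + V) / A = M / A + M / A + V / A := by ring
  rw [this]
  rw [abs_le] at *
  constructor <;> linarith [h1.1, h1.2, h2.1, h2.2, hi.1, hi.2]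

theorem hasDerivAt_exp_sq_sub_sq_mul (b y t : ℝ) :
    HasDerivAt (fun t => exp ((b ^ 2 - t ^ 2) * y)) (exp ((b ^ 2 - t ^ 2) * y) * (-2 * t * y)) t := by
  have := ((((hasDerivAt_id t).pow 2).const_sub (b ^ 2)).mul_const y).exp
  refine this.congr_deriv ?_
  simp

theorem hasDerivAt_div_sq_add_sq {d : ℝ} (hd : d ≠ 0) (t : ℝ) :
    HasDerivAt (fun t => t / (t ^ 2 + d ^ 2)) ((d ^ 2 - t ^ 2) / (t ^ 2 + d ^ 2) ^ 2) t := by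
  have h0 : t ^ 2 + d ^ 2 ≠ 0 := by positivity
  have := (hasDerivAt_id t).div (((hasDerivAt_id t).pow 2).add_const (d ^ 2)) h0
  refine this.congr_deriv ?_
  simp
  ring

/-- For t ≥ 1/A one has t/(t² + d²) ≤ 1/t ≤ A, so the amplitude has supremum at most A. Its
variation is at most 2A: one A from the monotone weight with values in [0,1], one from ∫ 1/t² ≤ 1/p
≤ A. Integration by parts gives (2A + 2A)/A. -/
theorem abs_integral_far_le {b y d A p q : ℝ} (hd : d ≠ 0) (hA : 0 < A)
    (hp : A⁻¹ ≤ p) (hpq : p ≤ q) (hw : ∀ t ∈ Icc p q, (b ^ 2 - t ^ 2) * y ≤ 0) :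
    |∫ t in p..q, exp ((b ^ 2 - t ^ 2) * y) * (t / (t ^ 2 + d ^ 2)) * sin (A * t)| ≤ 4 := by
  set w : ℝ → ℝ := fun t => exp ((b ^ 2 - t ^ 2) * y) with hwdef
  have hp0 : 0 < p := lt_of_lt_of_le (inv_pos.2 hA) hp
  have hw1 : ∀ t ∈ Icc p q, w t ≤ 1 := fun t ht => exp_le_one_iff.2 (hw t ht)
  have hw0 : ∀ t, 0 < w t := fun t => exp_pos _
  have htA : ∀ t ∈ Icc p q, 0 < t ∧ t⁻¹ ≤ A := fun t ht => by
    have : 0 < t := hp0.trans_le ht.1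
    exact ⟨this, inv_le_of_inv_le₀ hA (hp.trans ht.1)⟩
  have hh : ∀ t ∈ Icc p q, 0 ≤ t / (t ^ 2 + d ^ 2) ∧ t / (t ^ 2 + d ^ 2) ≤ A := fun t ht => by
    obtain ⟨h0, h1⟩ := htA t ht
    refine ⟨by positivity, le_trans ?_ h1⟩
    rw [div_le_iff₀ (by positivity), inv_mul_eq_div, le_div_iff₀ h0]
    nlinarith [sq_nonneg d]
  set f' : ℝ → ℝ := fun t => w t * (-2 * t * y) * (t / (t ^ 2 + d ^ 2)) +
    w t * ((d ^ 2 - t ^ 2) / (t ^ 2 + d ^ 2) ^ 2) with hf'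
  have hf'c : Continuous f' := by
    have : ∀ t : ℝ, t ^ 2 + d ^ 2 ≠ 0 := fun t => by positivity
    have : ∀ t : ℝ, (t ^ 2 + d ^ 2) ^ 2 ≠ 0 := fun t => by positivity
    simp only [hf', hwdef]
    fun_prop (disch := assumption)
  -- With e the sign of y, -e·w is a primitive of |w'| on t > 0 whether w increases or decreases.
  obtain ⟨e, he, he1⟩ : ∃ e : ℝ, e * y = |y| ∧ |e| ≤ 1 := by
    rcases le_total 0 y with h | h
    · exact ⟨1, by simp [abs_of_nonneg h], by simp⟩
    · exact ⟨-1, by simp [abs_of_nonpos h], by simp⟩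
  have hg : ∀ t ∈ uIcc p q, HasDerivAt (fun t => -(A * e) * w t - t⁻¹)
      (A * (w t * (2 * t * |y|)) + (t ^ 2)⁻¹) t := by
    intro t ht
    rw [uIcc_of_le hpq] at ht
    refine (((hasDerivAt_exp_sq_sub_sq_mul b y t).const_mul (-(A * e))).sub
      (hasDerivAt_inv (htA t ht).1.ne')).congr_deriv ?_
    rw [← he]
    ring
  have hgi : IntervalIntegrable (fun t => A * (w t * (2 * t * |y|)) + (t ^ 2)⁻¹) volume p q := by
    apply ContinuousOn.intervalIntegrable
    rw [uIcc_of_le hpq]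
    have : ∀ t ∈ Icc p q, t ^ 2 ≠ 0 := fun t ht => by
      have := (htA t ht).1
      positivity
    simp only [hwdef]
    fun_prop (disch := assumption)
  have hV : ∫ t in p..q, |f' t| ≤ 2 * A := by
    calc ∫ t in p..q, |f' t| ≤ ∫ t in p..q, (A * (w t * (2 * t * |y|)) + (t ^ 2)⁻¹) := by
          refine integral_mono_on hpq hf'c.abs.continuousOn.intervalIntegrable hgi fun t ht => ?_
          obtain ⟨h0, -⟩ := htA t ht
          refine (abs_add_le _ _).trans (add_le_add ?_ ?_)
          · rw [abs_mul, abs_of_nonneg (hh t ht).1, abs_mul, abs_of_pos (hw0 t),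
              abs_mul, abs_mul, abs_neg, abs_two, abs_of_pos h0, mul_comm]
            have := (hw0 t).le
            gcongr
            exact (hh t ht).2
          · rw [abs_mul, abs_of_pos (hw0 t), abs_div, abs_of_nonneg (sq_nonneg (t ^ 2 + d ^ 2))]
            have h1 : |d ^ 2 - t ^ 2| ≤ t ^ 2 + d ^ 2 := by
              rw [abs_le]
              constructor <;> nlinarith [sq_nonneg d, sq_nonneg t]
            calc w t * (|d ^ 2 - t ^ 2| / (t ^ 2 + d ^ 2) ^ 2)
                ≤ 1 * ((t ^ 2 + d ^ 2) / (t ^ 2 + d ^ 2) ^ 2) := by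
                  gcongr
                  exact hw1 t ht
              _ = (t ^ 2 + d ^ 2)⁻¹ := by
                  have : t ^ 2 + d ^ 2 ≠ 0 := by positivity
                  field_simp
              _ ≤ (t ^ 2)⁻¹ := by
                  gcongr
                  nlinarith [sq_nonneg d]
      _ = A * (e * (w p - w q)) + (p⁻¹ - q⁻¹) := by
          rw [integral_eq_sub_of_hasDerivAt hg hgi]
          ring
      _ ≤ A * 1 + A := by
          have h1 := hw1 p (left_mem_Icc.2 hpq)
          have h2 := hw1 q (right_mem_Icc.2 hpq)
          have h3 := hw0 p
          have h4 := hw0 q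
          have h5 : e * (w p - w q) ≤ 1 := by
            refine (le_abs_self _).trans ?_
            rw [abs_mul]
            have : |w p - w q| ≤ 1 := by
              rw [abs_le]
              constructor <;> linarith
            exact mul_le_one₀ he1 (abs_nonneg _) this
          have h6 := (htA p (left_mem_Icc.2 hpq)).2
          have h7 : 0 < q⁻¹ := inv_pos.2 (hp0.trans_le hpq)
          have := mul_le_mul_of_nonneg_left h5 hA.le
          linarith
      _ = 2 * A := by ring
  have key := abs_integral_mul_sin_le (M := A) hpq hA
    (fun t _ => (hasDerivAt_exp_sq_sub_sq_mul b y t).mul (hasDerivAt_div_sq_add_sq hd t))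
    hf'c.continuousOn (fun t ht => by
      change |w t * (t / (t ^ 2 + d ^ 2))| ≤ A
      rw [abs_mul, abs_of_pos (hw0 t), abs_of_nonneg (hh t ht).1]
      nlinarith [hw1 t ht, hw0 t, hh t ht]) hV
  refine key.trans (le_of_eq ?_)
  field_simp
  ring

/-- Since |sin(At)| ≤ At and t²/(t² + d²) ≤ 1, the integrand is at most A, on an interval of length
at most 1/A. -/
theorem abs_integral_near_le {b y d A p q : ℝ} (hd : d ≠ 0) (hA : 0 < A)
    (hp : 0 ≤ p) (hpq : p ≤ q) (hq : q ≤ A⁻¹) (hw : ∀ t ∈ Icc p q, (b ^ 2 - t ^ 2) * y ≤ 0) :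
    |∫ t in p..q, exp ((b ^ 2 - t ^ 2) * y) * (t / (t ^ 2 + d ^ 2)) * sin (A * t)| ≤ 1 := by
  have : ‖∫ t in p..q, exp ((b ^ 2 - t ^ 2) * y) * (t / (t ^ 2 + d ^ 2)) * sin (A * t)‖
      ≤ A * |q - p| := by
    refine norm_integral_le_of_norm_le_const fun t ht => ?_
    rw [uIoc_of_le hpq] at ht
    have h0 : 0 ≤ t := hp.trans ht.1.le
    have h1 : exp ((b ^ 2 - t ^ 2) * y) ≤ 1 := exp_le_one_iff.2 (hw t ⟨ht.1.le, ht.2⟩)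
    have h2 : 0 ≤ t / (t ^ 2 + d ^ 2) := by positivity
    rw [norm_mul, norm_mul, norm_of_nonneg (exp_pos _).le, norm_of_nonneg h2, Real.norm_eq_abs]
    have h3 : |sin (A * t)| ≤ A * t := by
      refine abs_sin_le_abs.trans (le_of_eq (abs_of_nonneg (by positivity)))
    calc exp ((b ^ 2 - t ^ 2) * y) * (t / (t ^ 2 + d ^ 2)) * |sin (A * t)|
        ≤ 1 * (t / (t ^ 2 + d ^ 2)) * (A * t) := by gcongr
      _ = A * (t ^ 2 / (t ^ 2 + d ^ 2)) := by ring
      _ ≤ A * 1 := by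
        gcongr
        rw [div_le_one (by positivity)]
        nlinarith [sq_nonneg d]
      _ = A := mul_one A
  refine this.trans ?_
  rw [abs_of_nonneg (sub_nonneg.2 hpq)]
  have h4 : A * (q - p) ≤ A * A⁻¹ := by
    gcongr
    linarith
  rwa [mul_inv_cancel₀ hA.ne'] at h4

theorem abs_integral_exp_mul_sin_le {b y d p q : ℝ} (A : ℝ) (hd : d ≠ 0)
    (hp : 0 ≤ p) (hpq : p ≤ q) (hw : ∀ t ∈ Icc p q, (b ^ 2 - t ^ 2) * y ≤ 0) :
    |∫ t in p..q, exp ((b ^ 2 - t ^ 2) * y) * (t / (t ^ 2 + d ^ 2)) * sin (A * t)| ≤ 5 := by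
  -- The integral is odd in A. For A > 0 it is cut at 1/A, the scale where oscillation sets in: 5 =
  -- 1 + 4.
  wlog hA : 0 < A generalizing A
  · rcases (not_lt.1 hA).eq_or_lt with rfl | hA
    · simp
    · have := this (-A) (neg_pos.2 hA)
      simpa [sin_neg, mul_neg, intervalIntegral.integral_neg, abs_neg] using this
  rcases le_total A⁻¹ p with h | h
  · linarith [abs_integral_far_le hd hA h hpq hw]
  rcases le_total q A⁻¹ with h' | h'
  · linarith [abs_integral_near_le hd hA hp hpq h' hw]
  have hi : ∀ r s : ℝ, IntervalIntegrable
      (fun t => exp ((b ^ 2 - t ^ 2) * y) * (t / (t ^ 2 + d ^ 2)) * sin (A * t)) volume r s := by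
    intro r s
    have : ∀ t : ℝ, t ^ 2 + d ^ 2 ≠ 0 := fun t => by positivity
    apply Continuous.intervalIntegrable
    fun_prop (disch := assumption)
  rw [← integral_add_adjacent_intervals (hi p A⁻¹) (hi A⁻¹ q)]
  have h1 := abs_integral_near_le hd hA hp h le_rfl
    (fun t ht => hw t ⟨ht.1, ht.2.trans h'⟩)
  have h2 := abs_integral_far_le hd hA le_rfl h' (fun t ht => hw t ⟨h.trans ht.1, ht.2⟩)
  exact (abs_add_le _ _).trans (by linarith)

/-! ### The truncated Gaussian weight -/

/-- The modulus of the exponential factor of the continuous part on the half-lines `|t| > |b|`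
(for `y > 0`) or on the interval `|t| < |b|` (for `y < 0`), where `t = re (lam + s)` and
`b = re lam`. -/
noncomputable def gaussWeight (b y t : ℝ) : ℝ := if (b ^ 2 - t ^ 2) * y < 0 then exp ((b ^ 2 - t ^ 2) * y) else 0

theorem gaussWeight_nonneg (b y t : ℝ) : 0 ≤ gaussWeight b y t := by
  unfold gaussWeight
  split_ifs <;> positivity

theorem gaussWeight_le_one (b y t : ℝ) : gaussWeight b y t ≤ 1 := by
  unfold gaussWeight
  split_ifs with h
  · exact exp_le_one_iff.2 h.le
  · exact zero_le_one

theorem gaussWeight_neg (b y t : ℝ) : gaussWeight b y (-t) = gaussWeight b y t := by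
  simp [gaussWeight]

theorem gaussWeight_abs (b y t : ℝ) : gaussWeight b y |t| = gaussWeight b y t := by
  simp [gaussWeight]

theorem measurable_gaussWeight (b y : ℝ) : Measurable (gaussWeight b y) := by
  unfold gaussWeight
  exact Measurable.ite (measurableSet_lt (by fun_prop) (by fun_prop)) (by fun_prop) (by fun_prop)

/-- On its support the exponent is -|y||t - b||t + b|; replacing the larger of the two distances by
the smaller leaves a Gaussian centred at b or -b. -/
theorem gaussWeight_le_gaussian (b y t : ℝ) :
    gaussWeight b y t ≤ exp (-|y| * (t - b) ^ 2) + exp (-|y| * (t + b) ^ 2) := by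
  unfold gaussWeight
  split_ifs with h
  · have h1 : (b ^ 2 - t ^ 2) * y = -(|t - b| * |t + b| * |y|) := by
      rw [← abs_mul, ← abs_mul, show (t - b) * (t + b) * y = -((b ^ 2 - t ^ 2) * y) by ring,
        abs_neg, abs_of_neg h, neg_neg]
    rw [h1]
    have hy := abs_nonneg y
    rcases le_total |t - b| |t + b| with hle | hle
    · refine le_trans (exp_le_exp.2 ?_) (le_add_of_nonneg_right (exp_pos _).le)
      rw [← sq_abs (t - b)]
      have := mul_le_mul_of_nonneg_left hle (abs_nonneg (t - b))
      nlinarith [mul_le_mul_of_nonneg_right this hy]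
    · refine le_trans (exp_le_exp.2 ?_) (le_add_of_nonneg_left (exp_pos _).le)
      rw [← sq_abs (t + b)]
      have := mul_le_mul_of_nonneg_left hle (abs_nonneg (t + b))
      nlinarith [mul_le_mul_of_nonneg_right this hy]
  · positivity

theorem integrable_gaussian_pair {y : ℝ} (b : ℝ) (hy : y ≠ 0) :
    Integrable fun t => exp (-|y| * (t - b) ^ 2) + exp (-|y| * (t + b) ^ 2) := by
  have h := integrable_exp_neg_mul_sq (abs_pos.2 hy)
  exact (h.comp_sub_right b).add (h.comp_add_right b)

theorem integrable_gaussWeight {y : ℝ} (b : ℝ) (hy : y ≠ 0) : Integrable (gaussWeight b y) := by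
  refine (integrable_gaussian_pair b hy).mono' (measurable_gaussWeight b y).aestronglyMeasurable
    (.of_forall fun t => ?_)
  rw [norm_of_nonneg (gaussWeight_nonneg b y t)]
  exact gaussWeight_le_gaussian b y t

theorem integral_gaussWeight_le {y : ℝ} (b : ℝ) (hy : y ≠ 0) :
    ∫ t, gaussWeight b y t ≤ 2 * √π * (1 / √|y|) := by
  have h := integrable_exp_neg_mul_sq (abs_pos.2 hy)
  calc ∫ t, gaussWeight b y t
      ≤ ∫ t, (exp (-|y| * (t - b) ^ 2) + exp (-|y| * (t + b) ^ 2)) :=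
        integral_mono (integrable_gaussWeight b hy) (integrable_gaussian_pair b hy)
          (gaussWeight_le_gaussian b y)
    _ = 2 * √(π / |y|) := by
        rw [integral_add (h.comp_sub_right b) (h.comp_add_right b),
          integral_sub_right_eq_self (fun t => exp (-|y| * t ^ 2)),
          integral_add_right_eq_self (fun t => exp (-|y| * t ^ 2)), integral_gaussian, two_mul]
    _ = 2 * √π * (1 / √|y|) := by
        rw [sqrt_div pi_pos.le]
        ring

theorem integrable_gaussWeight_mul {y C : ℝ} (b : ℝ) (hy : y ≠ 0) {g : ℝ → ℂ} (hg : Continuous g)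
    (hC : ∀ t, ‖g t‖ ≤ C) : Integrable fun t => (gaussWeight b y t : ℂ) * g t :=
  (integrable_gaussWeight b hy).ofReal.mul_bdd hg.aestronglyMeasurable (.of_forall hC)

theorem setIntegral_gaussWeight (b y : ℝ) (g : ℝ → ℝ) :
    ∫ t in Ioi 0, gaussWeight b y t * g t =
      ∫ t in Ioi 0 ∩ {t | (b ^ 2 - t ^ 2) * y < 0}, exp ((b ^ 2 - t ^ 2) * y) * g t := by
  rw [← setIntegral_indicator (measurableSet_lt (by fun_prop) (by fun_prop))]
  refine integral_congr_ae (.of_forall fun t => ?_)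
  simp only [gaussWeight, indicator, mem_ofPred_eq]
  split_ifs <;> simp

theorem integrable_gaussWeight_mul_sin {y d : ℝ} (b A : ℝ) (hy : y ≠ 0) (hd : d ≠ 0) :
    Integrable fun t => gaussWeight b y t * (t / (t ^ 2 + d ^ 2) * sin (A * t)) := by
  have hden : ∀ t : ℝ, t ^ 2 + d ^ 2 ≠ 0 := fun t => by positivity
  -- The bound 1/|d| degenerates as d → 0, but it serves integrability only.
  refine (integrable_gaussWeight b hy).mul_bdd (c := |d|⁻¹)
    (Continuous.aestronglyMeasurable (by fun_prop (disch := assumption))) (.of_forall fun t => ?_)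
  have hd' := abs_pos.2 hd
  rw [norm_mul, norm_div, Real.norm_eq_abs, Real.norm_eq_abs, Real.norm_eq_abs,
    abs_of_pos (by positivity : 0 < t ^ 2 + d ^ 2)]
  refine (mul_le_of_le_one_right (by positivity) (abs_sin_le_one _)).trans ?_
  rw [div_le_iff₀ (by positivity), inv_mul_eq_div, le_div_iff₀ hd', ← sq_abs t, ← sq_abs d]
  nlinarith [sq_nonneg (|t| - |d|), abs_nonneg t]

/-- On t > 0 the support of the weight is the single interval (0, |b|) for y < 0 and (|b|, ∞) for y
> 0, so the interval bound applies, after a limit in the unbounded case. -/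
theorem abs_integral_Ioi_gaussWeight_mul_sin_le {y d : ℝ} (b A : ℝ) (hy : y ≠ 0) (hd : d ≠ 0) :
    |∫ t in Ioi 0, gaussWeight b y t * (t / (t ^ 2 + d ^ 2) * sin (A * t))| ≤ 5 := by
  rw [setIntegral_gaussWeight]
  simp_rw [← mul_assoc]
  rcases hy.lt_or_gt with hy | hy
  · have hS : Ioi 0 ∩ {t | (b ^ 2 - t ^ 2) * y < 0} = Ioo 0 |b| := by
      ext t
      simp only [mem_inter_iff, mem_Ioi, mem_ofPred_eq, mem_Ioo, and_congr_right_iff]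
      intro ht
      rw [mul_neg_iff, ← abs_of_pos ht, ← sq_lt_sq, abs_of_pos ht]
      constructor
      · rintro (⟨h, -⟩ | ⟨-, h⟩) <;> linarith
      · exact fun h => .inl ⟨by linarith, hy⟩
    rw [hS, ← integral_Ioc_eq_integral_Ioo, ← integral_of_le (abs_nonneg b)]
    refine abs_integral_exp_mul_sin_le A hd le_rfl (abs_nonneg b) fun t ht => ?_
    have : t ^ 2 ≤ b ^ 2 := sq_le_sq.2 (by rw [abs_of_nonneg ht.1]; exact ht.2)
    exact mul_nonpos_of_nonneg_of_nonpos (by linarith) hy.le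
  · have hS : Ioi 0 ∩ {t | (b ^ 2 - t ^ 2) * y < 0} = Ioi |b| := by
      ext t
      simp only [mem_inter_iff, mem_Ioi, mem_ofPred_eq]
      constructor
      · rintro ⟨ht, h⟩
        rw [← abs_of_pos ht, ← sq_lt_sq]
        rcases mul_neg_iff.1 h with ⟨-, h⟩ | ⟨h, -⟩ <;> linarith
      · intro h
        have h1 : b ^ 2 < t ^ 2 := sq_lt_sq.2 (h.trans_le (le_abs_self t))
        exact ⟨(abs_nonneg b).trans_lt h, mul_neg_of_neg_of_pos (by linarith) hy⟩
    rw [hS]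
    have hint : IntegrableOn (fun t => exp ((b ^ 2 - t ^ 2) * y) * (t / (t ^ 2 + d ^ 2))
        * sin (A * t)) (Ioi |b|) := by
      refine (integrable_gaussWeight_mul_sin b A hy.ne' hd).integrableOn.congr_fun (fun t ht => ?_)
        measurableSet_Ioi
      have h : (b ^ 2 - t ^ 2) * y < 0 := (hS.symm.subset ht).2
      simp only [gaussWeight, if_pos h, mul_assoc]
    refine le_of_tendsto (intervalIntegral_tendsto_integral_Ioi |b| hint Filter.tendsto_id).abs ?_
    filter_upwards [Filter.eventually_ge_atTop |b|] with q hq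
    refine abs_integral_exp_mul_sin_le A hd (abs_nonneg b) hq fun t ht => ?_
    have : b ^ 2 ≤ t ^ 2 := sq_le_sq.2 (ht.1.trans (le_abs_self t))
    exact mul_nonpos_of_nonpos_of_nonneg (by linarith) hy.le

theorem abs_integral_gaussWeight_mul_sin_le {y d : ℝ} (b A : ℝ) (hy : y ≠ 0) (hd : d ≠ 0) :
    |∫ t, gaussWeight b y t * (t / (t ^ 2 + d ^ 2) * sin (A * t))| ≤ 10 := by
  have h : ∀ t, gaussWeight b y t * (t / (t ^ 2 + d ^ 2) * sin (A * t)) =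
      gaussWeight b y |t| * (|t| / (|t| ^ 2 + d ^ 2) * sin (A * |t|)) := fun t => by
    rw [gaussWeight_abs, sq_abs]
    rcases abs_choice t with h | h <;> rw [h]
    rw [mul_neg, sin_neg]
    ring
  rw [integral_congr_ae (.of_forall h), integral_comp_abs (f := fun t => gaussWeight b y t * (t / (t ^ 2 + d ^ 2) * sin (A * t))),
    abs_mul, abs_two]
  linarith [abs_integral_Ioi_gaussWeight_mul_sin_le b A hy hd]

/-! ### The Cauchy kernel and the pole terms -/

theorem integrable_cauchy {d : ℝ} (hd : d ≠ 0) : Integrable fun t => |d| / (t ^ 2 + d ^ 2) := by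
  have h := (integrable_inv_one_add_sq.comp_div hd).const_mul |d|⁻¹
  refine h.congr (.of_forall fun t => ?_)
  have := abs_pos.2 hd
  have h2 := sq_abs d
  simp only [div_pow, ← h2]
  field_simp
  ring

theorem integral_cauchy {d : ℝ} (hd : d ≠ 0) : ∫ t, |d| / (t ^ 2 + d ^ 2) = π := by
  have h := Measure.integral_comp_div (fun t : ℝ => (1 + t ^ 2)⁻¹) d
  rw [integral_univ_inv_one_add_sq, smul_eq_mul] at h
  have h0 := abs_pos.2 hd
  have : ∀ t, |d| / (t ^ 2 + d ^ 2) = |d|⁻¹ * (1 + (t / d) ^ 2)⁻¹ := fun t => by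
    have h2 := sq_abs d
    simp only [div_pow, ← h2]
    field_simp
    ring
  simp_rw [this]
  rw [MeasureTheory.integral_const_mul, h]
  field_simp

theorem ofReal_add_I_mul_ne_zero {d : ℝ} (hd : d ≠ 0) (t : ℝ) : (t : ℂ) + Complex.I * d ≠ 0 := by
  intro h
  have := congrArg Complex.im h
  simp at this
  exact hd this

theorem continuous_inv_ofReal_add_I_mul {d : ℝ} (hd : d ≠ 0) :
    Continuous fun t : ℝ => ((t : ℂ) + Complex.I * d)⁻¹ := by
  have := ofReal_add_I_mul_ne_zero hd
  fun_prop (disch := assumption)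

theorem norm_inv_ofReal_add_I_mul_le {d : ℝ} (hd : d ≠ 0) (t : ℝ) :
    ‖((t : ℂ) + Complex.I * d)⁻¹‖ ≤ |d|⁻¹ := by
  rw [norm_inv]
  refine inv_anti₀ (abs_pos.2 hd) ?_
  simpa using Complex.abs_im_le_norm ((t : ℂ) + Complex.I * d)

theorem norm_cexp_neg_I_mul (A t : ℝ) : ‖Complex.exp (-Complex.I * (A * t))‖ = 1 := by
  rw [Complex.norm_exp]
  simp

theorem integrable_gaussWeight_mul_pole {y d : ℝ} (b A : ℝ) (hy : y ≠ 0) (hd : d ≠ 0) :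
    Integrable fun t : ℝ => (gaussWeight b y t : ℂ) *
      (Complex.exp (-Complex.I * (A * t)) * ((t : ℂ) + Complex.I * d)⁻¹) := by
  have := continuous_inv_ofReal_add_I_mul hd
  refine integrable_gaussWeight_mul b hy (C := |d|⁻¹) (by fun_prop) fun t => ?_
  rw [norm_mul, norm_cexp_neg_I_mul, one_mul]
  exact norm_inv_ofReal_add_I_mul_le hd t

/-- The even part of a pole term is all that survives integration against an even weight. It splits
into a sine term, where oscillation is needed, and a cosine term that is absolutely integrable
uniformly in d. -/
theorem cexp_div_add_cexp_div {d : ℝ} (A : ℝ) (hd : d ≠ 0) (t : ℝ) :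
    Complex.exp (-Complex.I * (A * t)) * ((t : ℂ) + Complex.I * d)⁻¹ +
      Complex.exp (-Complex.I * (A * (-t : ℝ))) * (((-t : ℝ) : ℂ) + Complex.I * d)⁻¹ =
    (-2 * Complex.I) * ((t / (t ^ 2 + d ^ 2) * sin (A * t) : ℝ) +
      (d / (t ^ 2 + d ^ 2) * cos (A * t) : ℝ)) := by
  have h1 := ofReal_add_I_mul_ne_zero hd t
  have h2 := ofReal_add_I_mul_ne_zero hd (-t)
  have h3 : (t : ℂ) ^ 2 + (d : ℂ) ^ 2 ≠ 0 := by
    have : t ^ 2 + d ^ 2 ≠ 0 := by positivity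
    exact_mod_cast this
  have e1 : ((t : ℂ) + Complex.I * d)⁻¹ = (t - Complex.I * d) / (t ^ 2 + d ^ 2) := by
    rw [eq_div_iff h3, inv_mul_eq_iff_eq_mul₀ h1]
    ring_nf
    simp
  have e2 : (((-t : ℝ) : ℂ) + Complex.I * d)⁻¹ = (-t - Complex.I * d) / (t ^ 2 + d ^ 2) := by
    rw [eq_div_iff h3, inv_mul_eq_iff_eq_mul₀ h2]
    push_cast
    ring_nf
    simp
  have e3 : Complex.exp (-Complex.I * (A * t)) =
      Complex.cos (A * t) - Complex.sin (A * t) * Complex.I := by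
    rw [show -Complex.I * (A * t : ℂ) = (-(A * t)) * Complex.I by ring, Complex.exp_mul_I]
    simp
    ring
  have e4 : Complex.exp (-Complex.I * (A * (-t : ℝ))) =
      Complex.cos (A * t) + Complex.sin (A * t) * Complex.I := by
    rw [← Complex.exp_mul_I]
    congr 1
    push_cast
    ring
  rw [e1, e2, e3, e4]
  push_cast
  field_simp
  ring_nf

theorem norm_integral_gaussWeight_mul_pole_le {y d : ℝ} (b A : ℝ) (hy : y ≠ 0) (hd : d ≠ 0) :
    ‖∫ t : ℝ, (gaussWeight b y t : ℂ) *
      (Complex.exp (-Complex.I * (A * t)) * ((t : ℂ) + Complex.I * d)⁻¹)‖ ≤ 10 + π := by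
  set F : ℝ → ℂ := fun t => (gaussWeight b y t : ℂ) *
      (Complex.exp (-Complex.I * (A * t)) * ((t : ℂ) + Complex.I * d)⁻¹) with hF
  have hFi : Integrable F := integrable_gaussWeight_mul_pole b A hy hd
  have hden : ∀ t : ℝ, t ^ 2 + d ^ 2 ≠ 0 := fun t => by positivity
  have hs := integrable_gaussWeight_mul_sin b A hy hd
  have hcb : ∀ t, ‖gaussWeight b y t * (d / (t ^ 2 + d ^ 2) * cos (A * t))‖
      ≤ |d| / (t ^ 2 + d ^ 2) := fun t => by
    rw [norm_mul, norm_mul, norm_of_nonneg (gaussWeight_nonneg b y t), norm_div,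
      Real.norm_eq_abs, norm_of_nonneg (by positivity : 0 ≤ t ^ 2 + d ^ 2), Real.norm_eq_abs]
    calc gaussWeight b y t * (|d| / (t ^ 2 + d ^ 2) * |cos (A * t)|)
        ≤ 1 * (|d| / (t ^ 2 + d ^ 2) * 1) := by
          gcongr
          · exact gaussWeight_le_one b y t
          · exact abs_cos_le_one _
      _ = _ := by ring
  have hc : Integrable fun t => gaussWeight b y t * (d / (t ^ 2 + d ^ 2) * cos (A * t)) := by
    refine (integrable_cauchy hd).mono' ?_ (.of_forall hcb)
    exact (measurable_gaussWeight b y).aestronglyMeasurable.mul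
      (Continuous.aestronglyMeasurable (by fun_prop (disch := assumption)))
  -- The integral is symmetrized under t ↦ -t, the weight being even.
  have h2 : 2 * ∫ t, F t = (-2 * Complex.I) *
      ((∫ t, gaussWeight b y t * (t / (t ^ 2 + d ^ 2) * sin (A * t)) : ℝ) +
        (∫ t, gaussWeight b y t * (d / (t ^ 2 + d ^ 2) * cos (A * t)) : ℝ)) := by
    have : 2 * ∫ t, F t = ∫ t, (F t + F (-t)) := by
      rw [MeasureTheory.integral_add hFi hFi.comp_neg, integral_neg_eq_self F, two_mul]
    rw [this, ← integral_complex_ofReal, ← integral_complex_ofReal,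
      ← MeasureTheory.integral_add hs.ofReal hc.ofReal, ← MeasureTheory.integral_const_mul]
    refine integral_congr_ae (.of_forall fun t => ?_)
    simp only [hF]
    rw [gaussWeight_neg, ← mul_add, cexp_div_add_cexp_div A hd]
    push_cast
    ring
  have h3 : ‖∫ t, F t‖ =
      ‖((∫ t, gaussWeight b y t * (t / (t ^ 2 + d ^ 2) * sin (A * t)) : ℝ) : ℂ) +
        (∫ t, gaussWeight b y t * (d / (t ^ 2 + d ^ 2) * cos (A * t)) : ℝ)‖ := by
    have := congrArg norm h2
    simpa using this
  rw [h3]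
  refine (norm_add_le _ _).trans (add_le_add ?_ ?_)
  · rw [Complex.norm_real]
    exact abs_integral_gaussWeight_mul_sin_le b A hy hd
  · rw [Complex.norm_real, ← integral_cauchy hd]
    exact norm_integral_le_of_norm_le (integrable_cauchy hd) (.of_forall hcb)

/-! ### Logistic factors and the discrete part -/

/-- The logistic function `1 / (1 + exp (-2κx))`. -/
noncomputable def logistic (κ x : ℝ) : ℝ := 1 / (1 + exp (-2 * κ * x))

theorem logistic_nonneg (κ x : ℝ) : 0 ≤ logistic κ x := by
  unfold logistic
  positivity

theorem logistic_le_one (κ x : ℝ) : logistic κ x ≤ 1 := by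
  unfold logistic
  rw [div_le_one (by positivity)]
  linarith [exp_pos (-2 * κ * x)]

theorem one_sub_logistic (κ x : ℝ) : 1 - logistic κ x = 1 / (1 + exp (2 * κ * x)) := by
  unfold logistic
  have h : exp (-2 * κ * x) = (exp (2 * κ * x))⁻¹ := by rw [← exp_neg]; congr 1; ring
  rw [h]
  have := exp_pos (2 * κ * x)
  field_simp
  ring

/-- For x ≥ 0 the exponential is at most 1, for x ≤ 0 at most exp(-2κx); both are terms of the
logistic denominator. -/
theorem exp_mul_logistic_le_one {κ c : ℝ} (x : ℝ) (h0 : 0 ≤ c) (h1 : c ≤ 2 * κ) :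
    exp (-(c * x)) * logistic κ x ≤ 1 := by
  unfold logistic
  rw [mul_one_div, div_le_one (by positivity)]
  rcases le_total 0 x with hx | hx
  · have : exp (-(c * x)) ≤ 1 := exp_le_one_iff.2 (by nlinarith)
    linarith [exp_pos (-2 * κ * x)]
  · have : exp (-(c * x)) ≤ exp (-2 * κ * x) := exp_le_exp.2 (by nlinarith)
    linarith

theorem exp_mul_one_sub_logistic_le_one {κ c : ℝ} (x : ℝ) (h0 : 0 ≤ c) (h1 : c ≤ 2 * κ) :
    exp (c * x) * (1 - logistic κ x) ≤ 1 := by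
  have h := exp_mul_logistic_le_one (-x) h0 h1
  rw [one_sub_logistic]
  simpa [logistic] using h

theorem varphiPlus_eq (κ x : ℝ) (mu : ℂ) :
    varphiPlus κ x mu = 1 - 2 * Complex.I * κ / (mu + Complex.I * κ) * logistic κ x := rfl

theorem varphiMinus_eq (κ x : ℝ) (mu : ℂ) :
    varphiMinus κ x mu = 1 + 2 * Complex.I * κ / (mu - Complex.I * κ) * logistic κ x := rfl

theorem varthetaPlus_eq (κ x : ℝ) (mu : ℂ) :
    varthetaPlus κ x mu = 1 - 2 * Complex.I * κ / (mu + Complex.I * κ) * (1 - logistic κ x) := by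
  rw [varthetaPlus, ← one_sub_logistic]
  push_cast
  rfl

theorem varthetaMinus_eq (κ x : ℝ) (mu : ℂ) :
    varthetaMinus κ x mu = 1 + 2 * Complex.I * κ / (mu - Complex.I * κ) * (1 - logistic κ x) := by
  rw [varthetaMinus, ← one_sub_logistic]
  push_cast
  rfl

/-- At iκ the coefficient 2iκ/(μ + iκ) equals 1, so each amplitude is a pure logistic tail, able to
absorb exponential growth up to rate 2κ. -/
theorem gFun_I_mul {κ : ℝ} (hκ : 0 < κ) (x x' : ℝ) :
    gFun κ x x' (Complex.I * κ) = ((1 - logistic κ x) * logistic κ x' : ℝ) := by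
  have h0 : (κ : ℂ) ≠ 0 := by exact_mod_cast hκ.ne'
  have h1 := Complex.I_ne_zero
  have h : 2 * Complex.I * κ / (Complex.I * κ + Complex.I * κ) = 1 := by
    field_simp
    ring
  rw [gFun, if_pos (by simpa using hκ), varphiPlus_eq, varthetaPlus_eq, h]
  push_cast
  ring

theorem gFun_neg_I_mul {κ : ℝ} (hκ : 0 < κ) (x x' : ℝ) :
    gFun κ x x' (-(Complex.I * κ)) = ((1 - logistic κ x') * logistic κ x : ℝ) := by
  have h0 : (κ : ℂ) ≠ 0 := by exact_mod_cast hκ.ne'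
  have h1 := Complex.I_ne_zero
  have h : 2 * Complex.I * κ / (-(Complex.I * κ) - Complex.I * κ) = -1 := by
    rw [show -(Complex.I * κ) - Complex.I * κ = -(2 * Complex.I * κ) by ring, div_neg, div_self]
    simp [h0]
  rw [gFun, if_neg (by simpa using hκ.le), varphiMinus_eq, varthetaMinus_eq, h]
  push_cast
  ring

theorem norm_greenD_mul_cexp_le {κ : ℝ} (hκ : 0 < κ) (x x' y : ℝ) (lam : ℂ) :
    ‖greenD κ x x' y lam * Complex.exp (Complex.I * lam * (x - x'))‖ ≤ 2 * κ := by
  by_cases hy : 0 < -y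
  swap
  · simp [greenD, heaviside, hy, hκ.le]
  by_cases hl : 0 < κ - |lam.im|
  swap
  · simp [greenD, heaviside, hl, hκ.le]
  have hl1 := neg_abs_le lam.im
  have hl2 := le_abs_self lam.im
  -- The real part is (λ_R² + κ² - λ_I²)y, where |λ_I| < κ and y < 0.
  have hre : ((lam ^ 2 + (κ : ℂ) ^ 2) * y).re ≤ 0 := by
    have h : ((lam ^ 2 + (κ : ℂ) ^ 2) * y).re = (lam.re ^ 2 + (κ ^ 2 - lam.im ^ 2)) * y := by
      simp [pow_two, -mul_eq_mul_right_iff]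
      ring
    rw [h]
    have : lam.im ^ 2 ≤ κ ^ 2 := sq_le_sq.2 (by rw [abs_of_pos hκ]; linarith)
    exact mul_nonpos_of_nonneg_of_nonpos (by nlinarith [sq_nonneg lam.re]) (by linarith)
  have key : ‖(if 0 < lam.im then
      Complex.exp ((lam ^ 2 + κ ^ 2) * y + κ * (x - x')) * gFun κ x x' (Complex.I * κ)
    else
      Complex.exp ((lam ^ 2 + κ ^ 2) * y - κ * (x - x')) * gFun κ x x' (-(Complex.I * κ))) *
      Complex.exp (Complex.I * lam * (x - x'))‖ ≤ 1 := by
    split_ifs with him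
    · rw [gFun_I_mul hκ, mul_right_comm, ← Complex.exp_add, norm_mul, Complex.norm_exp,
        Complex.norm_real, norm_of_nonneg (mul_nonneg
          (sub_nonneg.2 (logistic_le_one κ x)) (logistic_nonneg κ x'))]
      -- The combined exponential in x - x' has modulus exp((κ - λ_I)(x - x')), with rate between 0
      -- and 2κ; it is split between the tails in x and x'. The lower half plane uses the rate κ +
      -- λ_I, with x and x' exchanged.
      have h1 := exp_mul_one_sub_logistic_le_one (κ := κ) (c := κ - lam.im) x
        (by linarith) (by linarith)
      have h2 := exp_mul_logistic_le_one (κ := κ) (c := κ - lam.im) x' (by linarith) (by linarith)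
      have h3 : ((lam ^ 2 + κ ^ 2) * y + κ * (x - x') + Complex.I * lam * (x - x')).re =
          ((lam ^ 2 + (κ : ℂ) ^ 2) * y).re + ((κ - lam.im) * x + -((κ - lam.im) * x')) := by
        simp [-Complex.mul_re, Complex.mul_re Complex.I,
          Complex.mul_re (_ * _), Complex.mul_re (κ : ℂ)]
        ring
      rw [h3, exp_add, exp_add]
      have h4 := exp_le_one_iff.2 hre
      have n1 := mul_nonneg (exp_pos ((κ - lam.im) * x)).le (sub_nonneg.2 (logistic_le_one κ x))
      have n2 := mul_nonneg (exp_pos (-((κ - lam.im) * x'))).le (logistic_nonneg κ x')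
      calc _ = exp ((lam ^ 2 + (κ : ℂ) ^ 2) * y).re *
            ((exp ((κ - lam.im) * x) * (1 - logistic κ x)) *
            (exp (-((κ - lam.im) * x')) * logistic κ x')) := by ring
        _ ≤ 1 := mul_le_one₀ h4 (mul_nonneg n1 n2) (mul_le_one₀ h1 n2 h2)
    · rw [gFun_neg_I_mul hκ, mul_right_comm, ← Complex.exp_add, norm_mul, Complex.norm_exp,
        Complex.norm_real, norm_of_nonneg (mul_nonneg
          (sub_nonneg.2 (logistic_le_one κ x')) (logistic_nonneg κ x))]
      have h1 := exp_mul_one_sub_logistic_le_one (κ := κ) (c := κ + lam.im) x'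
        (by linarith) (by linarith)
      have h2 := exp_mul_logistic_le_one (κ := κ) (c := κ + lam.im) x (by linarith) (by linarith)
      have h3 : ((lam ^ 2 + κ ^ 2) * y - κ * (x - x') + Complex.I * lam * (x - x')).re =
          ((lam ^ 2 + (κ : ℂ) ^ 2) * y).re + ((κ + lam.im) * x' + -((κ + lam.im) * x)) := by
        simp [-Complex.mul_re, Complex.mul_re Complex.I,
          Complex.mul_re (_ * _), Complex.mul_re (κ : ℂ)]
        ring
      rw [h3, exp_add, exp_add]
      have h4 := exp_le_one_iff.2 hre
      have n1 := mul_nonneg (exp_pos ((κ + lam.im) * x')).le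
        (sub_nonneg.2 (logistic_le_one κ x'))
      have n2 := mul_nonneg (exp_pos (-((κ + lam.im) * x))).le (logistic_nonneg κ x)
      calc _ = exp ((lam ^ 2 + (κ : ℂ) ^ 2) * y).re *
            ((exp ((κ + lam.im) * x') * (1 - logistic κ x')) *
            (exp (-((κ + lam.im) * x)) * logistic κ x)) := by ring
        _ ≤ 1 := mul_le_one₀ h4 (mul_nonneg n1 n2) (mul_le_one₀ h1 n2 h2)
  rw [greenD, mul_assoc, norm_mul]
  have h5 : ‖(-2 * κ * heaviside (-y) * heaviside (κ - |lam.im|) : ℂ)‖ = 2 * κ := by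
    simp [heaviside, hy, hl, abs_of_pos hκ]
  rw [h5]
  exact mul_le_of_le_one_right (by positivity) key

/-! ### Reduction of the continuous part -/

/-- The partial fraction expansion of the product of Jost solutions over `a`. -/
theorem jostProd_div_a {κ : ℝ} (x x' : ℝ) {mu : ℂ}
    (h1 : mu + Complex.I * κ ≠ 0) (h2 : mu - Complex.I * κ ≠ 0) :
    jostProd κ x x' mu / a κ mu = Complex.exp (-Complex.I * mu * (x - x')) *
      (1 + 2 * Complex.I * κ * ((1 - logistic κ x) * logistic κ x') * (mu - Complex.I * κ)⁻¹ -
        2 * Complex.I * κ * (logistic κ x * (1 - logistic κ x')) * (mu + Complex.I * κ)⁻¹) := by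
  have hI := Complex.I_sq
  have hx : Complex.exp (-Complex.I * mu * (x - x')) =
      Complex.exp (-Complex.I * mu * x) * Complex.exp (Complex.I * mu * x') := by
    rw [← Complex.exp_add]
    congr 1
    ring
  rw [jostProd, a, hx]
  -- Both half planes lead to the same rational function, so no case distinction on the sign of λ_I
  -- remains in the integrand.
  split_ifs
  · rw [phiPlus, psiPlus, varphiPlus_eq, varthetaPlus_eq]
    field_simp
    ring
  · rw [phiMinus, psiMinus, varphiMinus_eq, varthetaMinus_eq]
    field_simp
    ring

/-- Up to a constant factor, the integrand of the continuous part as a function of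
`t = re (lam + s)`; here `b = re lam`, `l = im lam`, `p = (1 - logistic κ x) * logistic κ x'` and
`q = logistic κ x * (1 - logistic κ x')`. -/
noncomputable def reducedIntegrand (κ b l y A p q t : ℝ) : ℂ :=
  gaussWeight b y t * Complex.exp (-Complex.I * (A * t)) +
    2 * Complex.I * κ * p * (gaussWeight b y t *
      (Complex.exp (-Complex.I * (A * t)) * ((t : ℂ) + Complex.I * (l - κ : ℝ))⁻¹)) -
    2 * Complex.I * κ * q * (gaussWeight b y t *
      (Complex.exp (-Complex.I * (A * t)) * ((t : ℂ) + Complex.I * (l + κ : ℝ))⁻¹))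

theorem integrable_gaussWeight_mul_cexp {y : ℝ} (b A : ℝ) (hy : y ≠ 0) :
    Integrable fun t : ℝ => (gaussWeight b y t : ℂ) * Complex.exp (-Complex.I * (A * t)) :=
  integrable_gaussWeight_mul b hy (C := 1) (by fun_prop) fun t => (norm_cexp_neg_I_mul A t).le

theorem integrable_reducedIntegrand {κ l y : ℝ} (b A p q : ℝ) (hy : y ≠ 0) (h1 : l ≠ κ)
    (h2 : l ≠ -κ) : Integrable (reducedIntegrand κ b l y A p q) := by
  have h1 : l - κ ≠ 0 := sub_ne_zero.2 h1
  have h2 : l + κ ≠ 0 := fun h => h2 (by linarith)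
  exact ((integrable_gaussWeight_mul_cexp b A hy).add
    ((integrable_gaussWeight_mul_pole b A hy h1).const_mul _)).sub
    ((integrable_gaussWeight_mul_pole b A hy h2).const_mul _)

/-- The constant term costs the mass of the weight; each of the two pole terms has a coefficient of
size at most 2κ and an integral at most 10 + π. -/
theorem norm_integral_reducedIntegrand_le {κ l y p q : ℝ} (b A : ℝ) (hκ : 0 < κ) (hy : y ≠ 0)
    (h1 : l ≠ κ) (h2 : l ≠ -κ) (hp : |p| ≤ 1) (hq : |q| ≤ 1) :
    ‖∫ t, reducedIntegrand κ b l y A p q t‖ ≤ 2 * √π * (1 / √|y|) + 4 * κ * (10 + π) := by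
  have h1 : l - κ ≠ 0 := sub_ne_zero.2 h1
  have h2 : l + κ ≠ 0 := fun h => h2 (by linarith)
  have i0 := integrable_gaussWeight_mul_cexp b A hy
  have i1 := (integrable_gaussWeight_mul_pole b A hy h1).const_mul (2 * Complex.I * κ * p)
  have i2 := (integrable_gaussWeight_mul_pole b A hy h2).const_mul (2 * Complex.I * κ * q)
  have hn : ∀ r : ℝ, |r| ≤ 1 → ‖2 * Complex.I * κ * (r : ℂ)‖ ≤ 2 * κ := fun r hr => by
    simp only [norm_mul, Complex.norm_I, Complex.norm_real, Real.norm_eq_abs, abs_of_pos hκ,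
      Complex.norm_ofNat, mul_one]
    exact mul_le_of_le_one_right (by positivity) hr
  unfold reducedIntegrand
  rw [MeasureTheory.integral_sub ?_ i2, MeasureTheory.integral_add i0 i1,
    MeasureTheory.integral_const_mul, MeasureTheory.integral_const_mul]
  swap
  · exact i0.add i1
  have e0 : ‖∫ t : ℝ, (gaussWeight b y t : ℂ) * Complex.exp (-Complex.I * (A * t))‖ ≤
      2 * √π * (1 / √|y|) := by
    refine (MeasureTheory.norm_integral_le_of_norm_le
      (integrable_gaussWeight b hy) (.of_forall fun t => ?_)).trans
      (integral_gaussWeight_le b hy)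
    rw [norm_mul, norm_cexp_neg_I_mul, mul_one, Complex.norm_real,
      norm_of_nonneg (gaussWeight_nonneg b y t)]
  have e1 := norm_integral_gaussWeight_mul_pole_le b A hy h1
  have e2 := norm_integral_gaussWeight_mul_pole_le b A hy h2
  have f1 := mul_le_mul (hn p hp) e1 (norm_nonneg _) (by positivity)
  have f2 := mul_le_mul (hn q hq) e2 (norm_nonneg _) (by positivity)
  rw [← norm_mul] at f1 f2
  refine (norm_sub_le _ _).trans ((add_le_add_left (norm_add_le _ _) _).trans ?_)
  linarith

theorem re_sq_sub_add_ofReal_sq (lam : ℂ) (s : ℝ) :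
    (lam ^ 2 - (lam + s) ^ 2).re = lam.re ^ 2 - (lam.re + s) ^ 2 := by
  simp [pow_two]

/-- For either sign of y the cutoffs select exactly those s where the exponential decays, leaving
the truncated weight, the sign of y and a pure phase. -/
theorem heaviside_mul_chi_mul_cexp {y : ℝ} (hy : y ≠ 0) (lam : ℂ) (s : ℝ) :
    ((heaviside y * chiMinus lam s - heaviside (-y) * chiPlus lam s : ℝ) : ℂ) *
      Complex.exp ((lam ^ 2 - (lam + s) ^ 2) * y) =
    (SignType.sign y : ℝ) * gaussWeight lam.re y (lam.re + s) *
      Complex.exp (-2 * Complex.I * lam.im * s * y) := by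
  have he : Complex.exp ((lam ^ 2 - (lam + s) ^ 2) * y) =
      (exp ((lam.re ^ 2 - (lam.re + s) ^ 2) * y) : ℝ) *
        Complex.exp (-2 * Complex.I * lam.im * s * y) := by
    rw [Complex.ofReal_exp, ← Complex.exp_add]
    congr 1
    nth_rw 1 2 [← Complex.re_add_im lam]
    push_cast
    ring
  rw [he, ← mul_assoc, ← Complex.ofReal_mul, ← Complex.ofReal_mul]
  congr 2
  simp only [chiMinus, chiPlus, re_sq_sub_add_ofReal_sq, heaviside, gaussWeight]
  rcases hy.lt_or_gt with hy | hy
  · have h : (lam.re ^ 2 - (lam.re + s) ^ 2) * y < 0 ↔ 0 < lam.re ^ 2 - (lam.re + s) ^ 2 :=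
      ⟨fun h => pos_of_mul_neg_left h hy.le, fun h => mul_neg_of_pos_of_neg h hy⟩
    simp [hy, not_lt.2 hy.le, h, sign_neg hy]
    split_ifs <;> simp
  · have h : (lam.re ^ 2 - (lam.re + s) ^ 2) * y < 0 ↔ lam.re ^ 2 - (lam.re + s) ^ 2 < 0 :=
      ⟨fun h => neg_of_mul_neg_left h hy.le, fun h => mul_neg_of_neg_of_pos h hy⟩
    simp [hy, not_lt.2 hy.le, h, sign_pos hy]

/-- The phase in y and the Jost exponential both have exponents linear in s; together they form one
oscillation of frequency x - x' + 2yλ_I in t = s + λ_R. The prefactor, independent of s, carries the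
only growth, exp(λ_I(x - x')). -/
theorem greenIntegrand_eq {κ : ℝ} (x x' : ℝ) {y : ℝ} (hy : y ≠ 0) {lam : ℂ}
    (h1 : lam.im ≠ κ) (h2 : lam.im ≠ -κ) (s : ℝ) :
    greenIntegrand κ x x' y lam s =
      ((SignType.sign y : ℝ) / (2 * π) *
        Complex.exp (2 * Complex.I * lam.im * lam.re * y + lam.im * (x - x'))) *
      reducedIntegrand κ lam.re lam.im y (x - x' + 2 * lam.im * y)
        ((1 - logistic κ x) * logistic κ x') (logistic κ x * (1 - logistic κ x'))
        (s + lam.re) := by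
  have h1 : lam.im - κ ≠ 0 := sub_ne_zero.2 h1
  have h2 : lam.im + κ ≠ 0 := fun h => h2 (by linarith)
  have e1 : lam + s - Complex.I * κ = ((s + lam.re : ℝ) : ℂ) + Complex.I * (lam.im - κ : ℝ) := by
    nth_rw 1 [← Complex.re_add_im lam]
    push_cast
    ring
  have e2 : lam + s + Complex.I * κ = ((s + lam.re : ℝ) : ℂ) + Complex.I * (lam.im + κ : ℝ) := by
    nth_rw 1 [← Complex.re_add_im lam]
    push_cast
    ring
  have n1 : lam + s - Complex.I * κ ≠ 0 := e1 ▸ ofReal_add_I_mul_ne_zero h1 _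
  have n2 : lam + s + Complex.I * κ ≠ 0 := e2 ▸ ofReal_add_I_mul_ne_zero h2 _
  have e3 : Complex.exp (-2 * Complex.I * lam.im * s * y) *
      Complex.exp (-Complex.I * (lam + s) * (x - x')) =
      Complex.exp (2 * Complex.I * lam.im * lam.re * y + lam.im * (x - x')) *
      Complex.exp (-Complex.I * ((x - x' + 2 * lam.im * y : ℝ) * (s + lam.re : ℝ))) := by
    rw [← Complex.exp_add, ← Complex.exp_add]
    congr 1
    nth_rw 2 [← Complex.re_add_im lam]
    push_cast
    ring_nf
    simp
    ring
  rw [greenIntegrand, heaviside_mul_chi_mul_cexp hy,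
    mul_comm (2 * (π : ℂ)), ← div_div, jostProd_div_a x x' n2 n1, reducedIntegrand,
    ← e1, ← e2, add_comm lam.re s]
  calc _ = ((SignType.sign y : ℝ) : ℂ) / (2 * π) * gaussWeight lam.re y (s + lam.re) *
        (Complex.exp (-2 * Complex.I * lam.im * s * y) *
        Complex.exp (-Complex.I * (lam + s) * (x - x'))) * (1 + 2 * Complex.I * κ *
        ((1 - logistic κ x) * logistic κ x') * (lam + s - Complex.I * κ)⁻¹ -
        2 * Complex.I * κ * (logistic κ x * (1 - logistic κ x')) *
        (lam + s + Complex.I * κ)⁻¹) := by ring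
    _ = _ := by
      rw [e3]
      push_cast
      ring

end KPII

/-! ### The Green function estimate -/

theorem lemmaL (κ : ℝ) (hκ : 0 < κ) :
    ∃ C : ℝ, ∀ (x x' y : ℝ) (lam : ℂ), y ≠ 0 →
      lam.im ≠ 0 → lam.re ≠ 0 → lam.im ≠ κ → lam.im ≠ -κ →
      MeasureTheory.Integrable (KPII.greenIntegrand κ x x' y lam) ∧
      ‖KPII.greenTilde κ x x' y lam‖ ≤ C * (1 + 1 / √|y|) := by
  -- The summands come from the Gaussian mass, the two pole terms and the discrete part.
  refine ⟨2 * √Real.pi + (4 * κ * (10 + Real.pi) + 2 * κ), fun x x' y lam hy _ _ h1 h2 => ?_⟩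
  have hfun := funext (KPII.greenIntegrand_eq x x' hy h1 h2)
  have hlog : ∀ z, |KPII.logistic κ z| ≤ 1 ∧ |1 - KPII.logistic κ z| ≤ 1 := fun z => by
    have h0 := KPII.logistic_nonneg κ z
    have h1 := KPII.logistic_le_one κ z
    constructor <;> rw [abs_le] <;> constructor <;> linarith
  have hp : |(1 - KPII.logistic κ x) * KPII.logistic κ x'| ≤ 1 := by
    rw [abs_mul]
    exact mul_le_one₀ (hlog x).2 (abs_nonneg _) (hlog x').1
  have hq : |KPII.logistic κ x * (1 - KPII.logistic κ x')| ≤ 1 := by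
    rw [abs_mul]
    exact mul_le_one₀ (hlog x).1 (abs_nonneg _) (hlog x').2
  constructor
  · rw [hfun]
    exact ((KPII.integrable_reducedIntegrand _ _ _ _ hy h1 h2).comp_add_right lam.re).const_mul _
  rw [KPII.greenTilde, KPII.green, add_mul]
  have hC := KPII.norm_integral_reducedIntegrand_le lam.re (x - x' + 2 * lam.im * y) hκ hy h1 h2
    hp hq
  have hD := KPII.norm_greenD_mul_cexp_le hκ x x' y lam
  -- The growth exp(λ_I(x - x')) cancels against |exp(iλ(x - x'))|; the remaining factor 1/(2π) is
  -- merely bounded by 1.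
  have hconst : ‖((SignType.sign y : ℝ) / (2 * Real.pi) *
        Complex.exp (2 * Complex.I * lam.im * lam.re * y + lam.im * (x - x')) : ℂ) *
        Complex.exp (Complex.I * lam * (x - x'))‖ ≤ 1 := by
    rw [mul_assoc, ← Complex.exp_add, norm_mul, Complex.norm_exp]
    have hre : (2 * Complex.I * lam.im * lam.re * y + lam.im * (x - x') +
        Complex.I * lam * (x - x') : ℂ).re = 0 := by
      simp
    rw [hre, Real.exp_zero, mul_one, norm_div, Complex.norm_real]
    have hs : ‖((SignType.sign y : SignType) : ℝ)‖ = 1 := by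
      rcases hy.lt_or_gt with h | h <;> simp [h]
    rw [hs]
    have : ‖(2 * Real.pi : ℂ)‖ = 2 * Real.pi := by
      simp [abs_of_pos Real.pi_pos]
    rw [this, div_le_one (by positivity)]
    linarith [Real.pi_gt_three]
  have hGC : ‖KPII.greenC κ x x' y lam * Complex.exp (Complex.I * lam * (x - x'))‖ ≤
      2 * √Real.pi * (1 / √|y|) + 4 * κ * (10 + Real.pi) := by
    rw [KPII.greenC, hfun, MeasureTheory.integral_const_mul,
      MeasureTheory.integral_add_right_eq_self (KPII.reducedIntegrand κ lam.re lam.im y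
        (x - x' + 2 * lam.im * y) _ _), mul_right_comm, norm_mul]
    exact (mul_le_of_le_one_left (norm_nonneg _) hconst).trans hC
  refine (norm_add_le _ _).trans ((add_le_add hGC hD).trans ?_)
  have hs : 0 ≤ √Real.pi := Real.sqrt_nonneg _
  have hr : 0 ≤ 1 / √|y| := by positivity
  have hc : 0 ≤ 4 * κ * (10 + Real.pi) + 2 * κ := by positivity
  nlinarith [mul_nonneg hc hr]
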